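/- Let $\mathcal{A}=(A,X,\lambda,\mu)$ be an invertible automaton: $A$ (the states) and $X$ (the alphabet) are finite sets, $\lambda:A\times X\to A$, $\mu:A\times X\to X$, and $x\mapsto \mu(s,x)$ is a permutation of $X$ for every $s\in A$. Write $s\cdot x=\lambda(s,x)$ and $s\circ x=\mu(s,x)$, and extend these to finite words $u\in X^*$ by $s\circ(xu)=(s\circ x)\,((s\cdot x)\circ u)$ and $s\cdot(xu)=(s\cdot x)\cdot u$. The automaton group $G(\mathcal{A})$ is the group of permutations of $X^*$ generated by the maps $u\mapsto s\circ u$, $s\in A$. Let $F_A$ be the free group on $A$ in which every sink (a state $s$ with $s\circ x=x$ and $s\cdot x=s$ for all $x\in X$) is identified with $1$, and let $|w|$ be the reduced length of $w\in F_A$ in the non-sink states. Extend both operations to $w\in F_A$, $u\in X^*$ by $s^{-1}\circ(s\circ u)=u$, $s^{-1}\cdot(s\circ u)=(s\cdot u)^{-1}$, $(ww')\circ u=w'\circ(w\circ u)$ and $(ww')\cdot u=(w\cdot u)\,(w'\cdot(w\circ u))$. Call $\mathcal{A}$ reducible if for every $w\in F_A$, $w\neq 1$, with $w\circ x=x$ for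 some $x\in X$, there is an integer $n$ such that $|w\cdot u|<|w|$ for all words $u\in X^*$ of length at least $n$ with $w\circ u=u$. Theorem. If $\mathcal{A}$ is reducible and $G(\mathcal{A})$ is amenable (it admits a finitely additive left-invariant probability measure on all its subsets) and has exponential growth, then $G(\mathcal{A})$ is not finitely presented. -/

import Mathlib

/-- An invertible automaton with states `A` and alphabet `X`: reading the letter `x` in the state
`s`, it outputs `s ∘ x = output s x` and moves to the state `s · x = restrict s x`; every
`output s` is a permutation of the alphabet. Finiteness of `A` and `X` is assumed where needed. -/
structure InvertibleAutomaton (A : Type*) (X : Type*) where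
  /-- the restriction map `(s, x) ↦ s · x` -/
  restrict : A → X → A
  /-- the output map `(s, x) ↦ s ∘ x` -/
  output : A → Equiv.Perm X

namespace InvertibleAutomaton

variable {A X : Type*} (𝒜 : InvertibleAutomaton A X)

/-- A sink is a state `s` with `s ∘ x = x` and `s · x = s` for every letter `x`. -/
def IsSink (s : A) : Prop :=
  ∀ x, 𝒜.output s x = x ∧ 𝒜.restrict s x = s

/-- The transformation `u ↦ s ∘ u` of finite words, `s ∘ (x u) = (s ∘ x) ((s · x) ∘ u)`. -/
def run : A → List X → List X
  | _, [] => []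
  | s, x :: u => 𝒜.output s x :: run (𝒜.restrict s x) u

/-- The inverse of the transformation `u ↦ s ∘ u`. -/
def runInv : A → List X → List X
  | _, [] => []
  | s, y :: u => (𝒜.output s).symm y :: runInv (𝒜.restrict s ((𝒜.output s).symm y)) u

theorem runInv_run (s : A) (u : List X) : 𝒜.runInv s (𝒜.run s u) = u := by
  induction u generalizing s with
  | nil => rfl
  | cons x u ih => simp [run, runInv, ih]

theorem run_runInv (s : A) (u : List X) : 𝒜.run s (𝒜.runInv s u) = u := by
  induction u generalizing s with
  | nil => rfl
  | cons x u ih => simp [run, runInv, ih]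

/-- The state `s`, as a permutation of the set `List X` of finite words. -/
def perm (s : A) : Equiv.Perm (List X) where
  toFun := 𝒜.run s
  invFun := 𝒜.runInv s
  left_inv := 𝒜.runInv_run s
  right_inv := 𝒜.run_runInv s

/-- The automaton group `G(𝒜)`: the group of permutations of the set of finite words that is
generated by the transformations `u ↦ s ∘ u` for `s` a state. -/
def group : Subgroup (Equiv.Perm (List X)) :=
  Subgroup.closure (Set.range 𝒜.perm)

/-- The states that are not sinks. -/
abbrev Gen : Type _ := {s : A // ¬ 𝒜.IsSink s}

open Classical in
/-- The image of a state in the free group on the states, where a sink is identified with `1`. -/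
noncomputable def letter (s : A) : FreeGroup 𝒜.Gen :=
  if h : 𝒜.IsSink s then 1 else FreeGroup.of ⟨s, h⟩

/-- The restriction `s · u` of a state to a finite word, `s · (x u) = (s · x) · u`. -/
def restrictState (s : A) (u : List X) : A :=
  u.foldl 𝒜.restrict s

/-- The action on words of the signed letter `s` (for `(s, true)`) or `s⁻¹` (for `(s, false)`). -/
def signedAct : 𝒜.Gen × Bool → List X → List X
  | (s, true), u => 𝒜.perm s u
  | (s, false), u => (𝒜.perm s).symm u

/-- The restriction of a signed letter to a finite word: `s · u`, respectively
`s⁻¹ · u = (s · (s⁻¹ ∘ u))⁻¹`. -/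
noncomputable def signedRestrict : 𝒜.Gen × Bool → List X → FreeGroup 𝒜.Gen
  | (s, true), u => 𝒜.letter (𝒜.restrictState s u)
  | (s, false), u => (𝒜.letter (𝒜.restrictState s ((𝒜.perm s).symm u)))⁻¹

/-- The action of a word of signed letters; the first letter acts first. -/
def wordAct : List (𝒜.Gen × Bool) → List X → List X
  | [], u => u
  | e :: w, u => wordAct w (𝒜.signedAct e u)

/-- The restriction of a word of signed letters, `(e w) · u = (e · u) (w · (e ∘ u))`. -/
noncomputable def wordRestrict : List (𝒜.Gen × Bool) → List X → FreeGroup 𝒜.Gen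
  | [], _ => 1
  | e :: w, u => 𝒜.signedRestrict e u * wordRestrict w (𝒜.signedAct e u)

open Classical in
/-- The action `w ∘ u` of an element of the free group on a finite word. -/
noncomputable def freeAct (w : FreeGroup 𝒜.Gen) (u : List X) : List X :=
  𝒜.wordAct w.toWord u

open Classical in
/-- The restriction `w · u` of an element of the free group to a finite word. -/
noncomputable def freeRestrict (w : FreeGroup 𝒜.Gen) (u : List X) : FreeGroup 𝒜.Gen :=
  𝒜.wordRestrict w.toWord u

open Classical in
/-- The automaton is reducible if for every `w ≠ 1` in the free group on the states (with sinks
identified with `1`) that fixes some letter there is an `n` such that `|w · u| < |w|` for every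
word `u` of length at least `n` that is fixed by `w`; here `|·|` is the reduced length. In
particular this holds if `|w · u| < |w|` is known for all words `u` of length at least `n`, or for
those among them that begin with a letter fixed by `w`. -/
def IsReducible : Prop :=
  ∀ w : FreeGroup 𝒜.Gen, w ≠ 1 → (∃ x : X, 𝒜.freeAct w [x] = [x]) →
    ∃ n : ℕ, ∀ u : List X, n ≤ u.length → 𝒜.freeAct w u = u →
      (𝒜.freeRestrict w u).norm < w.norm

end InvertibleAutomaton

/-- A (discrete) group is amenable if it admits a finitely additive left-invariant probability
measure defined on all its subsets. -/
def IsAmenableGroup (G : Type*) [Group G] : Prop :=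
  ∃ m : Set G → ℝ, (∀ S, 0 ≤ m S) ∧ m Set.univ = 1 ∧
    (∀ S T, Disjoint S T → m (S ∪ T) = m S + m T) ∧
    ∀ (g : G) (S : Set G), m ((fun h => g * h) '' S) = m S

/-- The elements of `G` that are products of at most `n` elements of `S`. -/
def growthBall {G : Type*} [Group G] (S : Set G) (n : ℕ) : Set G :=
  {g | ∃ l : List G, l.length ≤ n ∧ (∀ s ∈ l, s ∈ S) ∧ l.prod = g}

/-- A group has exponential growth if it has a finite symmetric generating set whose growth
function is bounded below by `n ↦ c ^ n` for some `c > 1`. -/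
def HasExponentialGrowth (G : Type*) [Group G] : Prop :=
  ∃ S : Set G, S.Finite ∧ (∀ s ∈ S, s⁻¹ ∈ S) ∧ Subgroup.closure S = ⊤ ∧
    ∃ c : ℝ, 1 < c ∧ ∀ n : ℕ, c ^ n ≤ ((growthBall S n).ncard : ℝ)

/-! Let F be the free group on the non-sink states. The level kernels K_n form an ascending chain of
normal subgroups of F. By reducibility (induction on reduced length,
`IsReducible.exists_mem_levelKernel`) their union is the kernel of F → G. If G is finitely
presented, the chain reaches this kernel at some n (`ker_eq_of_ascending_union`).

Restriction to a word of length n is then a homomorphism from the level stabilizer to F that kills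
every relation of G. It factors through a subgroup of the amenable group G, so its image, being
free, is commutative (`IsAmenableGroup.map_commute`). Commutators of the stabilizer thus restrict to
1 at every word of length n, so they lie in K_n and vanish in G. Hence G is virtually abelian and
grows polynomially, against exponential growth. -/

/-! ### Amenability and free groups -/

namespace FreeGroup

theorem head_toWord_inv_of_mul {ι : Type*} [DecidableEq ι] (i : ι) (w : FreeGroup ι)
    (h : w.toWord.head? ≠ some (i, true)) :
    ((of i)⁻¹ * w).toWord.head? = some (i, false) := by
  have hred : IsReduced ((i, false) :: w.toWord) := by
    rw [isReduced_iff_reduce_eq]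
    have hw := reduce_toWord w
    rw [reduce.cons, hw]
    cases hL : w.toWord with
    | nil => rfl
    | cons e L =>
      obtain ⟨j, b⟩ := e
      simp only [hL, List.head?_cons, ne_eq, Option.some.injEq, Prod.mk.injEq, not_and] at h
      have : ¬ (i = j ∧ false = !b) := by
        rintro ⟨rfl, hb⟩
        exact h rfl (by simpa using hb.symm)
      exact if_neg this
  have hmk : (of i)⁻¹ * w = mk ((i, false) :: w.toWord) := by
    conv_lhs => rw [← mk_toWord (x := w)]
    rfl
  rw [hmk, toWord_mk, isReduced_iff_reduce_eq.1 hred]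
  rfl

end FreeGroup

/-- A finitely additive left-invariant probability measure on `G` excludes an equivariant map
from `G` to a free group of rank at least two. -/
theorem subsingleton_of_amenable_of_equivariant {G ι : Type*} [Group G]
    (hG : IsAmenableGroup G) (q : G → FreeGroup ι)
    (hq : ∀ i, ∃ g : G, ∀ x, q (g * x) = FreeGroup.of i * q x) : Subsingleton ι := by
  classical
  obtain ⟨m, hnn, huniv, hadd, hinv⟩ := hG
  have hmono : ∀ S T : Set G, S ⊆ T → m S ≤ m T := by
    intro S T hST
    have := hadd S (T \ S) Set.disjoint_sdiff_right
    rw [Set.union_sdiff_cancel hST] at this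
    linarith [hnn (T \ S)]
  have hsub : ∀ S T : Set G, m (S ∪ T) ≤ m S + m T := by
    intro S T
    have := hadd S (T \ S) Set.disjoint_sdiff_right
    rw [Set.union_sdiff_self] at this
    linarith [hmono (T \ S) T Set.sdiff_subset]
  let W : ι → Bool → Set G := fun i b => {x | (q x).toWord.head? = some (i, b)}
  have hcover : ∀ i, 1 ≤ m (W i true ∪ W i false) := by
    intro i
    obtain ⟨g, hg⟩ := hq i
    -- The paradoxical decomposition of the free group, pulled back along `q`. It gives each
    -- generator measure at least 1, so two distinct generators would give total measure at least 2.
    have hU : (Set.univ : Set G) ⊆ W i true ∪ (fun h => g * h) '' W i false := by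
      intro x _
      by_cases hx : (q x).toWord.head? = some (i, true)
      · exact Or.inl hx
      · refine Or.inr ⟨g⁻¹ * x, ?_, by simp⟩
        have h1 := hg (g⁻¹ * x)
        rw [mul_inv_cancel_left] at h1
        have h2 : q (g⁻¹ * x) = (FreeGroup.of i)⁻¹ * q x := by rw [h1]; group
        change (q (g⁻¹ * x)).toWord.head? = _
        rw [h2]
        exact FreeGroup.head_toWord_inv_of_mul i _ hx
    have h3 := hmono _ _ hU
    have h4 := hsub (W i true) ((fun h => g * h) '' W i false)
    rw [hinv] at h4
    have h5 : Disjoint (W i true) (W i false) := by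
      rw [Set.disjoint_left]
      intro x hx hx'
      have hx1 : (q x).toWord.head? = some (i, true) := hx
      have hx2 : (q x).toWord.head? = some (i, false) := hx'
      rw [hx1] at hx2
      simp at hx2
    rw [hadd _ _ h5]
    linarith
  refine ⟨fun i j => ?_⟩
  by_contra hij
  have hd : Disjoint (W i true ∪ W i false) (W j true ∪ W j false) := by
    have key : ∀ b c x, x ∈ W i b → x ∈ W j c → False := by
      intro b c x hx hx'
      have hx1 : (q x).toWord.head? = some (i, b) := hx
      have hx2 : (q x).toWord.head? = some (j, c) := hx'
      rw [hx1] at hx2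
      simp only [Option.some.injEq, Prod.mk.injEq] at hx2
      exact hij hx2.1
    rw [Set.disjoint_left]
    rintro x (hx | hx) (hx' | hx') <;> exact key _ _ x hx hx'
  have h1 := hadd _ _ hd
  have h2 := hmono _ _ (Set.subset_univ ((W i true ∪ W i false) ∪ (W j true ∪ W j false)))
  linarith [hcover i, hcover j]

theorem FreeGroup.mul_comm_of_subsingleton {ι : Type*} [Subsingleton ι] (x y : FreeGroup ι) :
    x * y = y * x := by
  have hof : ∀ i : ι, ∀ z : FreeGroup ι, Commute (of i) z := by
    intro i z
    induction z using FreeGroup.induction_on with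
    | C1 => exact Commute.one_right _
    | of j => rw [Subsingleton.elim i j]
    | inv_of j h => exact h.inv_right
    | mul a b ha hb => exact ha.mul_right hb
  have : Commute x y := by
    induction x using FreeGroup.induction_on with
    | C1 => exact Commute.one_left _
    | of j => exact hof j y
    | inv_of j h => exact h.inv_left
    | mul a b ha hb => exact ha.mul_left hb
  exact this

/-- A homomorphism from a subgroup to a free group that factors through a subgroup of an amenable
group has commutative image. -/
theorem IsAmenableGroup.map_commute {Γ G α : Type*} [Group Γ] [Group G]
    (hG : IsAmenableGroup G) (φ : Γ →* G) (ψ : Γ →* FreeGroup α)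
    (hker : ∀ h, φ h = 1 → ψ h = 1) (a b : Γ) : ψ a * ψ b = ψ b * ψ a := by
  have hψ : ∀ h k, φ h = φ k → ψ h = ψ k := by
    intro h k hhk
    have : ψ (h * k⁻¹) = 1 := hker _ (by simp [hhk])
    rwa [map_mul, map_inv, mul_inv_eq_one] at this
  let rel := QuotientGroup.rightRel φ.range
  let rep : G → G := fun g => (Quotient.mk rel g).out
  have hrep : ∀ g, ∃ h, g = φ h * rep g := by
    intro g
    have h1 : rel (rep g) g := Quotient.exact (Quotient.out_eq _)
    obtain ⟨h, hh⟩ := QuotientGroup.rightRel_apply.1 h1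
    exact ⟨h, by rw [hh]; group⟩
  have hrepmul : ∀ k g, rep (φ k * g) = rep g := by
    intro k g
    have : Quotient.mk rel (φ k * g) = Quotient.mk rel g := by
      apply Quotient.sound
      exact QuotientGroup.rightRel_apply.2 ⟨k⁻¹, by simp⟩
    change (Quotient.mk rel (φ k * g)).out = _
    rw [this]
  choose p hp using hrep
  -- The image is free by Nielsen–Schreier. Writing `g = φ (p g) * rep g` along right cosets of
  -- `φ.range` makes `q` equivariant on all of `G`, so no measure on the subgroup is needed.
  let e := IsFreeGroup.toFreeGroup ψ.range
  let q : G → FreeGroup (IsFreeGroup.Generators ψ.range) := fun g => e (ψ.rangeRestrict (p g))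
  have hq : ∀ k g, q (φ k * g) = e (ψ.rangeRestrict k) * q g := by
    intro k g
    have h1 : φ (p (φ k * g)) = φ (k * p g) := by
      have := hp (φ k * g)
      rw [hrepmul] at this
      conv at this => lhs; rw [hp g]
      rw [← mul_assoc] at this
      rw [map_mul]
      exact (mul_right_cancel this).symm
    have h2 : ψ.rangeRestrict (p (φ k * g)) = ψ.rangeRestrict (k * p g) :=
      Subtype.ext (hψ _ _ h1)
    change e (ψ.rangeRestrict (p (φ k * g))) = _
    rw [h2, map_mul, map_mul]
  have hsub : Subsingleton (IsFreeGroup.Generators ψ.range) := by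
    refine subsingleton_of_amenable_of_equivariant hG q fun i => ?_
    obtain ⟨k, hk⟩ := ψ.rangeRestrict_surjective (e.symm (FreeGroup.of i))
    exact ⟨φ k, fun x => by rw [hq, hk, e.apply_symm_apply]⟩
  have hcomm := FreeGroup.mul_comm_of_subsingleton (e (ψ.rangeRestrict a)) (e (ψ.rangeRestrict b))
  rw [← map_mul, ← map_mul, ← map_mul, ← map_mul] at hcomm
  simpa using congrArg Subtype.val (e.injective hcomm)

/-! ### Growth of virtually abelian groups -/

/-- A virtually abelian group does not have exponential growth. -/
theorem not_hasExponentialGrowth_of_virtually_abelian {G : Type*} [Group G] (N : Subgroup G)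
    [N.FiniteIndex] (hN : ∀ a ∈ N, ∀ b ∈ N, a * b = b * a) : ¬ HasExponentialGrowth G := by
  classical
  rintro ⟨S, hS, -, -, c, hc, hgrow⟩
  let _ : CommGroup N :=
    { (inferInstance : Group N) with mul_comm := fun a b => Subtype.ext (hN a a.2 b b.2) }
  let rel := QuotientGroup.rightRel N
  have hfin : Finite (Quotient rel) :=
    Finite.of_equiv _ (QuotientGroup.quotientRightRelEquivQuotientLeftRel N).symm
  let t : Quotient rel → G := fun x => x.out
  have hrep : ∀ g, ∃ (x : Quotient rel) (h : N), g = h * t x := by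
    intro g
    have h1 : rel (t (Quotient.mk rel g)) g := Quotient.exact (Quotient.out_eq _)
    have h2 := QuotientGroup.rightRel_apply.1 h1
    exact ⟨Quotient.mk rel g, ⟨_, h2⟩, by simp⟩
  choose r y hry using hrep
  have : Finite S := hS
  have := Fintype.ofFinite (Quotient rel)
  have := Fintype.ofFinite S
  -- Schreier generators of `N`: moving the coset representative rightwards past each letter emits
  -- one of them. As `N` is commutative, only their exponents matter.
  let Y : Quotient rel × S → N := fun i => y (t i.1 * i.2)
  have hword : ∀ l : List G, (∀ s ∈ l, s ∈ S) → ∃ (f : Quotient rel × S → ℕ) (x : Quotient rel),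
      (∀ i, f i ≤ l.length) ∧ l.prod = (y 1 * ∏ i, Y i ^ f i : N) * t x := by
    intro l
    induction l using List.reverseRecOn with
    | nil => exact fun _ => ⟨0, r 1, by simp, by simpa using hry 1⟩
    | append_singleton l s ih =>
      intro hl
      obtain ⟨f, x, hf, hprod⟩ := ih fun s hs => hl s (by simp [hs])
      let i₀ : Quotient rel × S := (x, ⟨s, hl s (by simp)⟩)
      refine ⟨f + Pi.single i₀ 1, r (t x * s), fun i => ?_, ?_⟩
      · have : (Pi.single i₀ 1 : Quotient rel × S → ℕ) i ≤ 1 := by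
          rw [Pi.single_apply]; split_ifs <;> simp
        simpa using add_le_add (hf i) this
      · have h1 : ∏ i, Y i ^ (f + Pi.single i₀ 1 : Quotient rel × S → ℕ) i = (∏ i, Y i ^ f i) * Y i₀ := by
          simp only [Pi.add_apply, pow_add, Finset.prod_mul_distrib]
          congr 1
          rw [Finset.prod_eq_single i₀] <;> simp +contextual
        rw [List.prod_append, List.prod_singleton, hprod, h1, mul_assoc]
        have h2 : t x * s = Y i₀ * t (r (t x * s)) := hry _
        refine (congrArg _ h2).trans ?_
        simp only [Subgroup.coe_mul, mul_assoc]
  set d := Fintype.card (Quotient rel × S) with hd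
  set C := Fintype.card (Quotient rel) with hC
  have hcard : ∀ n, (growthBall S n).ncard ≤ (n + 1) ^ d * C := by
    intro n
    let F : (Quotient rel × S → Fin (n + 1)) × Quotient rel → G := fun z =>
      (y 1 * ∏ i, Y i ^ (z.1 i : ℕ) : N) * t z.2
    have hsub : growthBall S n ⊆ Set.range F := by
      rintro g ⟨l, hln, hlS, rfl⟩
      obtain ⟨f, x, hf, hprod⟩ := hword l hlS
      exact ⟨(fun i => ⟨f i, by have := hf i; omega⟩, x), hprod.symm⟩
    calc (growthBall S n).ncard ≤ (Set.range F).ncard :=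
          Set.ncard_le_ncard hsub (Set.finite_range F)
      _ ≤ Nat.card ((Quotient rel × S → Fin (n + 1)) × Quotient rel) := by
          rw [← Set.image_univ, ← Set.ncard_univ]
          exact Set.ncard_image_le Set.finite_univ
      _ = (n + 1) ^ d * C := by simp [Nat.card_eq_fintype_card, hd, hC]
  -- The extra factor `c` absorbs the shift from `n` to `n + 1` in the exponent.
  have hlim := (tendsto_pow_const_div_const_pow_of_one_lt d hc).const_mul (c * C)
  have hlim' := hlim.comp (Filter.tendsto_add_atTop_nat 1)
  rw [mul_zero] at hlim'
  obtain ⟨n, hn⟩ := (hlim'.eventually_lt_const one_pos).exists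
  have hcn : 0 < c ^ (n + 1) := by positivity
  have h1 : (c : ℝ) ^ n ≤ (n + 1) ^ d * C := (hgrow n).trans (by exact_mod_cast hcard n)
  simp only [Function.comp_apply, ← mul_div_assoc] at hn
  rw [div_lt_one hcn, pow_succ' c] at hn
  push_cast at hn
  nlinarith [hc]

/-! ### Finite presentation and ascending chains -/

/-- In a finitely presented group the kernel of a surjection from a finitely generated free group
cannot be a proper ascending union of normal subgroups. -/
theorem ker_eq_of_ascending_union {α G : Type*} [Finite α] [Group G]
    [hG : Group.IsFinitelyPresented G] (φ : FreeGroup α →* G) (hφ : Function.Surjective φ)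
    (K : ℕ → Subgroup (FreeGroup α)) [∀ n, (K n).Normal] (hmono : Monotone K)
    (hK : ∀ w, φ w = 1 ↔ ∃ n, w ∈ K n) : ∃ n, ∀ w, φ w = 1 → w ∈ K n := by
  obtain ⟨k, f, hf, R, hRfin, hR⟩ := hG.out
  choose g₀ hg₀ using fun i : Fin k => hφ (f (FreeGroup.of i))
  choose h₀ hh₀ using fun a : α => hf (φ (FreeGroup.of a))
  let g : FreeGroup (Fin k) →* FreeGroup α := FreeGroup.lift g₀
  let h : FreeGroup α →* FreeGroup (Fin k) := FreeGroup.lift h₀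
  have hg : ∀ x, φ (g x) = f x := by
    have : φ.comp g = f := FreeGroup.ext_hom _ _ fun i => by simp [g, hg₀]
    exact fun x => DFunLike.congr_fun this x
  have hh : ∀ x, f (h x) = φ x := by
    have : f.comp h = φ := FreeGroup.ext_hom _ _ fun i => by simp [h, hh₀]
    exact fun x => DFunLike.congr_fun this x
  have hex : ∀ w, ∃ n, φ w = 1 → w ∈ K n := by
    intro w
    by_cases hw : φ w = 1
    · obtain ⟨n, hn⟩ := (hK w).1 hw
      exact ⟨n, fun _ => hn⟩
    · exact ⟨0, fun h => absurd h hw⟩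
  choose N hN using hex
  have := hRfin.to_subtype
  obtain ⟨n₁, hn₁⟩ := (Set.finite_range fun r : R => N (g r)).bddAbove
  obtain ⟨n₂, hn₂⟩ := (Set.finite_range fun a : α =>
    N ((FreeGroup.of a)⁻¹ * g (h (FreeGroup.of a)))).bddAbove
  -- Finitely many conditions suffice: modulo `K n`, `g` kills the relators of `f`, and `g ∘ h`
  -- fixes each generator.
  let n := max n₁ n₂
  have hrel : ∀ x, f x = 1 → g x ∈ K n := by
    have : f.ker ≤ (K n).comap g := by
      rw [← hR]
      refine Subgroup.normalClosure_le_normal fun r hr => ?_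
      have hfr : f r = 1 := by
        rw [← MonoidHom.mem_ker, ← hR]
        exact Subgroup.subset_normalClosure hr
      exact hmono ((hn₁ ⟨⟨r, hr⟩, rfl⟩).trans (le_max_left _ _)) (hN (g r) (by rw [hg, hfr]))
    exact fun x hx => this hx
  have hgh : ∀ w, (QuotientGroup.mk' (K n)) (g (h w)) = QuotientGroup.mk' (K n) w := by
    have : ((QuotientGroup.mk' (K n)).comp g).comp h = QuotientGroup.mk' (K n) := by
      refine FreeGroup.ext_hom _ _ fun a => Eq.symm ?_
      refine QuotientGroup.eq.2 ?_
      exact hmono ((hn₂ ⟨a, rfl⟩).trans (le_max_right _ _)) (hN _ (by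
        rw [map_mul, map_inv, hg, hh, inv_mul_cancel]))
    exact fun x => DFunLike.congr_fun this x
  refine ⟨n, fun w hw => ?_⟩
  have h1 : g (h w) ∈ K n := hrel _ (by rw [hh, hw])
  rw [← QuotientGroup.eq_one_iff] at h1 ⊢
  exact (hgh w).symm.trans h1

/-! ### Action and restriction on the free group -/

namespace InvertibleAutomaton

variable {A X : Type*} (𝒜 : InvertibleAutomaton A X)

/-- The homomorphism from the free group onto the automaton group; since `w ∘ u` is a right
action, a state is sent to the inverse of its transformation. -/
noncomputable def toPerm : FreeGroup 𝒜.Gen →* Equiv.Perm (List X) :=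
  FreeGroup.lift fun s => (𝒜.perm s)⁻¹

theorem wordAct_eq (L : List (𝒜.Gen × Bool)) (u : List X) :
    𝒜.wordAct L u = (𝒜.toPerm (FreeGroup.mk L))⁻¹ u := by
  induction L generalizing u with
  | nil => simp [wordAct, ← FreeGroup.one_eq_mk]
  | cons e L ih =>
    have h : FreeGroup.mk (e :: L) = FreeGroup.mk [e] * FreeGroup.mk L := by
      rw [FreeGroup.mul_mk]; rfl
    rw [wordAct, ih, h, map_mul, mul_inv_rev, Equiv.Perm.mul_apply]
    congr 1
    obtain ⟨s, _ | _⟩ := e <;> simp [signedAct, toPerm, FreeGroup.lift_mk]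

theorem freeAct_eq (w : FreeGroup 𝒜.Gen) (u : List X) :
    𝒜.freeAct w u = (𝒜.toPerm w)⁻¹ u := by
  classical
  rw [freeAct, wordAct_eq, FreeGroup.mk_toWord]

@[simp]
theorem freeAct_one (u : List X) : 𝒜.freeAct 1 u = u := by simp [freeAct_eq]

theorem freeAct_mul (w w' : FreeGroup 𝒜.Gen) (u : List X) :
    𝒜.freeAct (w * w') u = 𝒜.freeAct w' (𝒜.freeAct w u) := by simp [freeAct_eq]

theorem freeAct_of (s : 𝒜.Gen) (u : List X) : 𝒜.freeAct (FreeGroup.of s) u = 𝒜.run s u := by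
  simp [freeAct_eq, toPerm]; rfl

theorem freeAct_mk (L : List (𝒜.Gen × Bool)) (u : List X) :
    𝒜.freeAct (FreeGroup.mk L) u = 𝒜.wordAct L u := by
  rw [freeAct_eq, wordAct_eq]

theorem wordRestrict_append (L L' : List (𝒜.Gen × Bool)) (u : List X) :
    𝒜.wordRestrict (L ++ L') u = 𝒜.wordRestrict L u * 𝒜.wordRestrict L' (𝒜.wordAct L u) := by
  induction L generalizing u with
  | nil => simp [wordRestrict, wordAct]
  | cons e L ih => simp [wordRestrict, wordAct, ih, mul_assoc]

theorem signedAct_not (s : 𝒜.Gen) (b : Bool) (u : List X) :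
    𝒜.signedAct (s, !b) (𝒜.signedAct (s, b) u) = u := by
  cases b <;> simp [signedAct]

theorem signedRestrict_not (s : 𝒜.Gen) (b : Bool) (u : List X) :
    𝒜.signedRestrict (s, b) u * 𝒜.signedRestrict (s, !b) (𝒜.signedAct (s, b) u) = 1 := by
  cases b <;> simp [signedAct, signedRestrict]

/-- Adjacent inverse letters contribute mutually inverse restrictions, so restriction may be
computed on unreduced words. -/
theorem wordRestrict_eq_of_mk_eq {L L' : List (𝒜.Gen × Bool)}
    (h : FreeGroup.mk L = FreeGroup.mk L') (u : List X) :
    𝒜.wordRestrict L u = 𝒜.wordRestrict L' u := by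
  have hstep : ∀ L L', FreeGroup.Red.Step L L' → 𝒜.wordRestrict L u = 𝒜.wordRestrict L' u := by
    rintro _ _ ⟨⟩
    rename_i L₁ L₂ s b
    rw [wordRestrict_append, wordRestrict_append]
    simp only [wordRestrict, signedAct_not, ← mul_assoc]
    rw [mul_assoc _ (𝒜.signedRestrict (s, b) _), signedRestrict_not, mul_one]
  exact congrArg (Quot.lift (fun L => 𝒜.wordRestrict L u) hstep) h

theorem freeRestrict_mk (L : List (𝒜.Gen × Bool)) (u : List X) :
    𝒜.freeRestrict (FreeGroup.mk L) u = 𝒜.wordRestrict L u := by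
  classical
  exact 𝒜.wordRestrict_eq_of_mk_eq FreeGroup.mk_toWord u

@[simp]
theorem freeRestrict_one (u : List X) : 𝒜.freeRestrict 1 u = 1 := by
  rw [FreeGroup.one_eq_mk, freeRestrict_mk]; rfl

theorem freeRestrict_mul (w w' : FreeGroup 𝒜.Gen) (u : List X) :
    𝒜.freeRestrict (w * w') u = 𝒜.freeRestrict w u * 𝒜.freeRestrict w' (𝒜.freeAct w u) := by
  obtain ⟨L⟩ := w
  obtain ⟨L'⟩ := w'
  simp only [FreeGroup.quot_mk_eq_mk, FreeGroup.mul_mk, freeRestrict_mk, freeAct_mk,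
    wordRestrict_append]

theorem freeAct_inv_freeAct (w : FreeGroup 𝒜.Gen) (u : List X) :
    𝒜.freeAct w⁻¹ (𝒜.freeAct w u) = u := by
  rw [← freeAct_mul, mul_inv_cancel, freeAct_one]

theorem freeAct_freeAct_inv (w : FreeGroup 𝒜.Gen) (u : List X) :
    𝒜.freeAct w (𝒜.freeAct w⁻¹ u) = u := by
  rw [← freeAct_mul, inv_mul_cancel, freeAct_one]

theorem freeRestrict_inv (w : FreeGroup 𝒜.Gen) (u : List X) :
    𝒜.freeRestrict w⁻¹ u = (𝒜.freeRestrict w (𝒜.freeAct w⁻¹ u))⁻¹ := by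
  rw [eq_inv_iff_mul_eq_one, ← freeRestrict_mul, inv_mul_cancel, freeRestrict_one]

theorem freeRestrict_of (s : 𝒜.Gen) (u : List X) :
    𝒜.freeRestrict (FreeGroup.of s) u = 𝒜.letter (𝒜.restrictState s u) := by
  rw [FreeGroup.of, freeRestrict_mk]
  simp [wordRestrict, signedRestrict]

theorem IsSink.run_eq {s : A} (h : 𝒜.IsSink s) (u : List X) : 𝒜.run s u = u := by
  induction u with
  | nil => rfl
  | cons x u ih => rw [run, (h x).1, (h x).2, ih]

theorem IsSink.restrictState_eq {s : A} (h : 𝒜.IsSink s) (u : List X) :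
    𝒜.restrictState s u = s := by
  induction u with
  | nil => rfl
  | cons x u ih => rw [restrictState, List.foldl_cons, (h x).2]; exact ih

theorem freeAct_letter (s : A) (u : List X) : 𝒜.freeAct (𝒜.letter s) u = 𝒜.run s u := by
  by_cases h : 𝒜.IsSink s
  · simp [letter, h, IsSink.run_eq]
  · simp [letter, h, freeAct_of]

theorem freeRestrict_letter (s : A) (u : List X) :
    𝒜.freeRestrict (𝒜.letter s) u = 𝒜.letter (𝒜.restrictState s u) := by
  by_cases h : 𝒜.IsSink s
  · simp [letter, h, IsSink.restrictState_eq]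
  · rw [letter, dif_neg h, freeRestrict_of]

theorem run_append (s : A) (u v : List X) :
    𝒜.run s (u ++ v) = 𝒜.run s u ++ 𝒜.run (𝒜.restrictState s u) v := by
  induction u generalizing s with
  | nil => rfl
  | cons x u ih => simp only [List.cons_append, run, ih]; rfl

theorem length_freeAct (w : FreeGroup 𝒜.Gen) (u : List X) :
    (𝒜.freeAct w u).length = u.length := by
  have hrun : ∀ (u : List X) (s : A), (𝒜.run s u).length = u.length := by
    intro u
    induction u with
    | nil => exact fun _ => rfl
    | cons x u ih => exact fun s => by simp [run, ih]
  induction w using FreeGroup.induction_on generalizing u with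
  | C1 => simp
  | of s => rw [freeAct_of, hrun]
  | inv_of s h => rw [← h, freeAct_freeAct_inv]
  | mul w w' h h' => rw [freeAct_mul, h', h]

theorem freeAct_append (w : FreeGroup 𝒜.Gen) (u v : List X) :
    𝒜.freeAct w (u ++ v) = 𝒜.freeAct w u ++ 𝒜.freeAct (𝒜.freeRestrict w u) v := by
  induction w using FreeGroup.induction_on generalizing u v with
  | C1 => simp
  | of s => rw [freeAct_of, freeAct_of, freeRestrict_of, freeAct_letter, run_append]
  | inv_of s h =>
    have key := h (𝒜.freeAct (FreeGroup.of s)⁻¹ u)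
      (𝒜.freeAct (𝒜.freeRestrict (FreeGroup.of s)⁻¹ u) v)
    rw [freeAct_freeAct_inv, freeRestrict_inv, freeAct_freeAct_inv] at key
    rw [← key, freeAct_inv_freeAct, freeRestrict_inv]
  | mul w w' h h' => simp only [freeAct_mul, freeRestrict_mul, h, h']

theorem freeRestrict_append (w : FreeGroup 𝒜.Gen) (u v : List X) :
    𝒜.freeRestrict w (u ++ v) = 𝒜.freeRestrict (𝒜.freeRestrict w u) v := by
  induction w using FreeGroup.induction_on generalizing u v with
  | C1 => simp
  | of s =>
    rw [freeRestrict_of, freeRestrict_of, freeRestrict_letter, restrictState, List.foldl_append]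
    rfl
  | inv_of s h =>
    rw [freeRestrict_inv, freeAct_append, h, freeRestrict_inv _ _ u, freeRestrict_inv _ _ v]
  | mul w w' h h' => simp only [freeRestrict_mul, freeAct_append, h, h']

/-! ### Level stabilizers and level kernels -/

/-- The elements of the free group that fix all words of length `n`. -/
def levelStabilizer (n : ℕ) : Subgroup (FreeGroup 𝒜.Gen) where
  carrier := {w | ∀ u : List X, u.length = n → 𝒜.freeAct w u = u}
  one_mem' u _ := 𝒜.freeAct_one u
  mul_mem' {a b} ha hb u hu := by rw [freeAct_mul, ha u hu, hb u hu]
  inv_mem' {a} ha u hu := by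
    conv_lhs => rw [← ha u hu]
    rw [freeAct_inv_freeAct]

/-- The elements of the free group that fix all words of length `n` and restrict to the identity
there. -/
def levelKernel (n : ℕ) : Subgroup (FreeGroup 𝒜.Gen) where
  carrier := {w | ∀ u : List X, u.length = n → 𝒜.freeAct w u = u ∧ 𝒜.freeRestrict w u = 1}
  one_mem' u _ := ⟨𝒜.freeAct_one u, 𝒜.freeRestrict_one u⟩
  mul_mem' {a b} ha hb u hu := by
    rw [freeAct_mul, freeRestrict_mul, (ha u hu).1, (ha u hu).2, (hb u hu).1, (hb u hu).2]
    simp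
  inv_mem' {a} ha u hu := by
    have h : 𝒜.freeAct a⁻¹ u = u := by
      conv_lhs => rw [← (ha u hu).1]
      rw [freeAct_inv_freeAct]
    rw [freeRestrict_inv, h, (ha u hu).2]
    simp

instance levelKernel_normal (n : ℕ) : (𝒜.levelKernel n).Normal where
  conj_mem a ha g u hu := by
    have h := ha (𝒜.freeAct g u) (by rw [length_freeAct, hu])
    simp only [freeAct_mul, freeRestrict_mul, h.1, h.2, freeAct_inv_freeAct, freeRestrict_inv]
    simp

theorem levelKernel_mono : Monotone 𝒜.levelKernel := by
  intro n m hnm w hw u hu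
  have h := hw (u.take n) (by simp [hu, hnm])
  rw [← List.take_append_drop n u, freeAct_append, freeRestrict_append, h.1, h.2]
  simp

theorem toPerm_eq_one_iff (w : FreeGroup 𝒜.Gen) :
    𝒜.toPerm w = 1 ↔ ∀ u, 𝒜.freeAct w u = u := by
  simp only [freeAct_eq]
  rw [← inv_eq_one, Equiv.ext_iff]
  rfl

theorem toPerm_eq_one_of_mem_levelKernel {n : ℕ} {w : FreeGroup 𝒜.Gen}
    (hw : w ∈ 𝒜.levelKernel n) : 𝒜.toPerm w = 1 := by
  rw [toPerm_eq_one_iff]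
  have hlong : ∀ u : List X, n ≤ u.length → 𝒜.freeAct w u = u := fun u hu =>
    (𝒜.levelKernel_mono hu hw u rfl).1
  intro u
  rcases u with _ | ⟨x, u⟩
  · exact List.length_eq_zero_iff.1 (𝒜.length_freeAct w [])
  · have h := hlong ((x :: u) ++ List.replicate n x) (by simp; omega)
    rw [freeAct_append] at h
    exact (List.append_inj h (𝒜.length_freeAct w _)).1

theorem freeAct_freeRestrict_eq_self {w : FreeGroup 𝒜.Gen} (hw : ∀ u, 𝒜.freeAct w u = u)
    (u v : List X) : 𝒜.freeAct (𝒜.freeRestrict w u) v = v := by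
  have h := hw (u ++ v)
  rw [freeAct_append, hw u] at h
  exact List.append_cancel_left h

/-- In a reducible automaton every relation lies in some level kernel. -/
theorem IsReducible.exists_mem_levelKernel [Finite X] {𝒜 : InvertibleAutomaton A X}
    (hred : 𝒜.IsReducible) (w : FreeGroup 𝒜.Gen) (hw : ∀ u, 𝒜.freeAct w u = u) :
    ∃ n, w ∈ 𝒜.levelKernel n := by
  classical
  rcases isEmpty_or_nonempty X with hX | ⟨⟨x⟩⟩
  -- Over the empty alphabet reducibility says nothing, but level 1 has no words.
  · refine ⟨1, fun u hu => ?_⟩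
    obtain ⟨x, -⟩ := List.length_eq_one_iff.1 hu
    exact hX.elim x
  induction hk : w.norm using Nat.strong_induction_on generalizing w with
  | _ k ih =>
    by_cases hw1 : w = 1
    · exact ⟨0, hw1 ▸ one_mem _⟩
    obtain ⟨n, hn⟩ := hred w hw1 ⟨x, hw _⟩
    have hex : ∀ u : List.Vector X n, ∃ m, 𝒜.freeRestrict w u.1 ∈ 𝒜.levelKernel m := by
      intro u
      refine ih _ ?_ _ (𝒜.freeAct_freeRestrict_eq_self hw u.1) rfl
      have h := hn u.1 u.2.ge (hw _)
      rw [← hk]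
      convert h
    choose m hm using hex
    -- The finitely many restrictions at level `n` are shorter relations; one level `M` serves them
    -- all.
    obtain ⟨M, hM⟩ := (Set.finite_range m).bddAbove
    refine ⟨n + M, fun u hu => ⟨hw u, ?_⟩⟩
    have hlen : (u.take n).length = n := by simp [hu]
    have h := 𝒜.levelKernel_mono (hM ⟨⟨u.take n, hlen⟩, rfl⟩) (hm ⟨u.take n, hlen⟩)
      (u.drop n) (by simp [hu])
    rw [← List.take_append_drop n u, freeRestrict_append]
    exact h.2

/-! ### Passage to the automaton group -/

theorem range_toPerm : 𝒜.toPerm.range = 𝒜.group := by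
  have hmem : ∀ s : 𝒜.Gen, 𝒜.perm s ∈ 𝒜.group := fun s =>
    Subgroup.subset_closure ⟨s, rfl⟩
  apply le_antisymm
  · rw [toPerm, FreeGroup.range_lift_eq_closure, Subgroup.closure_le]
    rintro _ ⟨s, rfl⟩
    exact inv_mem (hmem s)
  · rw [group, Subgroup.closure_le]
    rintro _ ⟨s, rfl⟩
    refine ⟨(𝒜.letter s)⁻¹, ?_⟩
    ext1 u
    rw [map_inv, ← freeAct_eq, freeAct_letter]
    rfl

/-- The homomorphism `toPerm`, onto the automaton group. -/
noncomputable def toGroup : FreeGroup 𝒜.Gen →* 𝒜.group :=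
  𝒜.toPerm.codRestrict 𝒜.group fun w => 𝒜.range_toPerm ▸ ⟨w, rfl⟩

theorem toGroup_surjective : Function.Surjective 𝒜.toGroup := by
  rintro ⟨g, hg⟩
  rw [← range_toPerm] at hg
  obtain ⟨w, rfl⟩ := hg
  exact ⟨w, rfl⟩

theorem toGroup_eq_one_iff (w : FreeGroup 𝒜.Gen) :
    𝒜.toGroup w = 1 ↔ ∀ u, 𝒜.freeAct w u = u := by
  rw [← toPerm_eq_one_iff, Subtype.ext_iff]
  rfl

instance levelStabilizer_finiteIndex [Finite X] (n : ℕ) :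
    (𝒜.levelStabilizer n).FiniteIndex := by
  let f : FreeGroup 𝒜.Gen →* Equiv.Perm (List.Vector X n) :=
    { toFun w :=
        { toFun u := ⟨𝒜.freeAct w⁻¹ u.1, by rw [length_freeAct, u.2]⟩
          invFun u := ⟨𝒜.freeAct w u.1, by rw [length_freeAct, u.2]⟩
          left_inv u := Subtype.ext (𝒜.freeAct_freeAct_inv w u.1)
          right_inv u := Subtype.ext (𝒜.freeAct_inv_freeAct w u.1) }
      map_one' := by ext1 u; exact Subtype.ext (by simp; rfl)
      map_mul' w w' := by
        ext1 u
        exact Subtype.ext (by simp [freeAct_mul]; rfl) }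
  have h : f.ker ≤ 𝒜.levelStabilizer n := by
    intro w hw u hu
    have h1 := congrArg Subtype.val (Equiv.ext_iff.1 (MonoidHom.mem_ker.1 hw) ⟨u, hu⟩)
    change 𝒜.freeAct w⁻¹ u = u at h1
    conv_lhs => rw [← h1]
    rw [freeAct_freeAct_inv]
  exact Subgroup.finiteIndex_of_le h

/-- The restriction to a word of length `n` is multiplicative on the level stabilizer. -/
noncomputable def levelRestrict {n : ℕ} (u : List X) (hu : u.length = n) :
    𝒜.levelStabilizer n →* FreeGroup 𝒜.Gen where
  toFun w := 𝒜.freeRestrict w u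
  map_one' := 𝒜.freeRestrict_one u
  map_mul' w w' := by
    rw [Subgroup.coe_mul, freeRestrict_mul, w.2 u hu]

end InvertibleAutomaton

open InvertibleAutomaton in
theorem mainTheorem3 {A X : Type*} [Finite A] [Finite X] (𝒜 : InvertibleAutomaton A X)
    (hred : 𝒜.IsReducible) (hamen : IsAmenableGroup 𝒜.group)
    (hexp : HasExponentialGrowth 𝒜.group) :
    ¬ Group.IsFinitelyPresented 𝒜.group := by
  intro hfp
  obtain ⟨n, hn⟩ := ker_eq_of_ascending_union 𝒜.toGroup 𝒜.toGroup_surjective 𝒜.levelKernel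
    𝒜.levelKernel_mono fun w => by
      rw [toGroup_eq_one_iff]
      exact ⟨hred.exists_mem_levelKernel w, fun ⟨n, hw⟩ =>
        (𝒜.toPerm_eq_one_iff w).1 (𝒜.toPerm_eq_one_of_mem_levelKernel hw)⟩
  have hcomm : ∀ a b : 𝒜.levelStabilizer n,
      𝒜.toGroup a * 𝒜.toGroup b = 𝒜.toGroup b * 𝒜.toGroup a := by
    intro a b
    have hmem : ((a * b * (b * a)⁻¹ : 𝒜.levelStabilizer n) : FreeGroup 𝒜.Gen) ∈
        𝒜.levelKernel n := by
      intro u hu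
      refine ⟨(a * b * (b * a)⁻¹).2 u hu, ?_⟩
      have h := hamen.map_commute (𝒜.toGroup.comp (𝒜.levelStabilizer n).subtype)
        (𝒜.levelRestrict u hu) (fun w hw => (hn w hw u hu).2) a b
      change 𝒜.levelRestrict u hu (a * b * (b * a)⁻¹) = 1
      rw [map_mul, map_inv, map_mul, map_mul, h, mul_inv_cancel]
    have h := (𝒜.toGroup_eq_one_iff _).2
      ((𝒜.toPerm_eq_one_iff _).1 (𝒜.toPerm_eq_one_of_mem_levelKernel hmem))
    rwa [Subgroup.coe_mul, map_mul, Subgroup.coe_inv, map_inv, mul_inv_eq_one, Subgroup.coe_mul,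
      Subgroup.coe_mul, map_mul, map_mul] at h
  -- Under a surjection the index of the image divides the original index, which is nonzero.
  have hidx : ((𝒜.levelStabilizer n).map 𝒜.toGroup).FiniteIndex :=
    ⟨fun h => Subgroup.FiniteIndex.index_ne_zero (Nat.eq_zero_of_zero_dvd
      (h ▸ Subgroup.index_map_dvd _ 𝒜.toGroup_surjective))⟩
  refine not_hasExponentialGrowth_of_virtually_abelian ((𝒜.levelStabilizer n).map 𝒜.toGroup)
    ?_ hexp
  rintro _ ⟨a, ha, rfl⟩ _ ⟨b, hb, rfl⟩
  exact hcomm ⟨a, ha⟩ ⟨b, hb⟩
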